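/- Let $p,q,C,\lambda$ be real numbers with $0<2p<q<1$ and $C>0$. Consider a controlled queue $X_{t+1}=X_t-D_{t+1}+\nu_t\xi_{t+1}$, $t\ge 0$, with values in $\{0,1,2,\dots\}$ and controls $\nu_t\in\{0,1\}$, where, conditionally on the initial state, on $D_s,\xi_s$ for $1\le s\le t$ and on $\nu_s$ for $s\le t$, the variables $D_{t+1}$ and $\xi_{t+1}$ are independent, $D_{t+1}$ is binomial with parameters $X_t$ and $q/X_t$ (and $D_{t+1}=0$ if $X_t=0$), and $\xi_{t+1}$ is Bernoulli with parameter $p$; such $\{\nu_t\}$ are called admissible controls. For $0<\alpha<1$ let $$V_\alpha(x)=\inf_{\{\nu_t\}}\mathbb E\Big[\sum_{t=0}^\infty\alpha^t\big(CX_t+(1-\nu_t)\lambda\big)\,\Big|\,X_0=x\Big],$$ the infimum being over all admissible controls. Then the limits $$V(x)=\lim_{\alpha\uparrow1}\big(V_\alpha(x)-V_\alpha(0)\big)\quad(x=0,1,2,\dots),\qquad \beta=\lim_{\alpha\uparrow1}(1-\alpha)V_\alpha(0)$$ exist and are finite, and they satisfy the average-cost dynamic programming equation $$V(x)=Cx-\beta+\min\Big(\sum_{d=0}^{x}b_x(d)\big(pV(x+1-d)+(1-p)V(x-d)\big),\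 \lambda+\sum_{d=0}^{x}b_x(d)V(x-d)\Big),\qquad x\ge 0,$$ where $b_x(d)=\binom xd (q/x)^d(1-q/x)^{x-d}$ for $x\ge1$ and $b_0(0)=1$. Moreover the average-cost value function $V$ is strictly increasing in the queue length: $V(z)<V(y)$ whenever $y>z\ge 0$. -/

import Mathlib

open MeasureTheory Filter Topology

noncomputable section

namespace ProcessorSharing

/-- Probability of `d` departures in one slot from a queue holding `x` jobs, each of which leaves
with probability `q / x`.  An empty queue has no departures (`q / 0 = 0` and `0 ^ 0 = 1`). -/
def depProb (q : ℝ) (x d : ℕ) : ℝ :=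
  (x.choose d : ℝ) * (q / (x : ℝ)) ^ d * (1 - q / (x : ℝ)) ^ (x - d)

/-- Probability of `e` arrivals in one slot (Bernoulli with parameter `p`). -/
def arrProb (p : ℝ) (e : ℕ) : ℝ :=
  if e = 0 then 1 - p else if e = 1 then p else 0

/-- What has been observed at time `t` once the control of time `t` is chosen: the initial queue
length, the departures and arrivals of times `1, …, t`, and the controls of times `0, …, t`. -/
def history {Ω : Type} (X D ξ ν : ℕ → Ω → ℕ) (t : ℕ) (ω : Ω) :
    ℕ × (Fin t → ℕ × ℕ) × (Fin (t + 1) → ℕ) :=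
  (X 0 ω, fun s => (D ((s : ℕ) + 1) ω, ξ ((s : ℕ) + 1) ω), fun s => ν (s : ℕ) ω)

/-- `ν` is an admissible control, on the probability space `(Ω, P)`, for the queue `X` started at
`x`, with departures `D` and arrivals `ξ`. -/
structure IsAdmissible (p q : ℝ) (x : ℕ) {Ω : Type} [MeasurableSpace Ω] (P : Measure Ω)
    (X D ξ ν : ℕ → Ω → ℕ) : Prop where
  isProbabilityMeasure : IsProbabilityMeasure P
  measurable_queue : ∀ t, Measurable (X t)
  measurable_departure : ∀ t, Measurable (D t)
  measurable_arrival : ∀ t, Measurable (ξ t)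
  measurable_control : ∀ t, Measurable (ν t)
  arrival_mem : ∀ t ω, ξ t ω = 0 ∨ ξ t ω = 1
  control_mem : ∀ t ω, ν t ω = 0 ∨ ν t ω = 1
  initial : ∀ ω, X 0 ω = x
  /-- `X_{t+1} = X_t - D_{t+1} + ν_t ξ_{t+1}`, written without subtraction. -/
  dynamics : ∀ t ω, X (t + 1) ω + D (t + 1) ω = X t ω + ν t ω * ξ (t + 1) ω
  /-- Given the history up to time `t` and the control `ν_t`, the departures `D_{t+1}` and the
  arrival `ξ_{t+1}` are independent, binomial with parameters `X_t` and `q / X_t`, and Bernoulli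
  with parameter `p`. -/
  conditional_law : ∀ (t : ℕ) (S : Set (ℕ × (Fin t → ℕ × ℕ) × (Fin (t + 1) → ℕ))) (k d e : ℕ),
    P.real {ω | history X D ξ ν t ω ∈ S ∧ X t ω = k ∧ D (t + 1) ω = d ∧ ξ (t + 1) ω = e} =
      depProb q k d * arrProb p e * P.real {ω | history X D ξ ν t ω ∈ S ∧ X t ω = k}

/-- The running cost `C x + (1 - ν) lam`. -/
def cost (C lam : ℝ) (x ν : ℕ) : ℝ := C * (x : ℝ) + (1 - (ν : ℝ)) * lam

/-- The expected infinite horizon `α`-discounted cost. -/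
def discountedCost (C lam α : ℝ) {Ω : Type} [MeasurableSpace Ω] (P : Measure Ω)
    (X ν : ℕ → Ω → ℕ) : ℝ :=
  ∫ ω, ∑' t : ℕ, α ^ t * cost C lam (X t ω) (ν t ω) ∂P

/-- The discounted value function: the optimal `α`-discounted cost from the initial queue length
`x` over all admissible controls. -/
def discountedValue (p q C lam α : ℝ) (x : ℕ) : ℝ :=
  sInf {J : ℝ | ∃ (Ω : Type) (_ : MeasurableSpace Ω) (P : Measure Ω) (X D ξ ν : ℕ → Ω → ℕ),
    IsAdmissible p q x P X D ξ ν ∧ J = discountedCost C lam α P X ν}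

/-- The average cost dynamic programming equation; the first term of the minimum is the active
mode, the second one the passive mode. -/
def SolvesDPE (p q C lam : ℝ) (V : ℕ → ℝ) (β : ℝ) : Prop :=
  ∀ x : ℕ, V x = C * (x : ℝ) - β +
    min (∑ d ∈ Finset.range (x + 1),
          depProb q x d * (p * V (x + 1 - d) + (1 - p) * V (x - d)))
        (lam + ∑ d ∈ Finset.range (x + 1), depProb q x d * V (x - d))

/-- `V` is the average cost value function, with average cost `β`: the vanishing discount limit
of the discounted value functions normalized at `0`, solving the dynamic programming equation. -/
structure IsAverageCostValue (p q C lam : ℝ) (V : ℕ → ℝ) (β : ℝ) : Prop where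
  tendsto_value : ∀ x : ℕ,
    Tendsto (fun α : ℝ => discountedValue p q C lam α x - discountedValue p q C lam α 0)
      (𝓝[<] 1) (𝓝 (V x))
  tendsto_cost :
    Tendsto (fun α : ℝ => (1 - α) * discountedValue p q C lam α 0) (𝓝[<] 1) (𝓝 β)
  solvesDPE : SolvesDPE p q C lam V β

end ProcessorSharing

end

/-!
The relative dynamic programming equation is solved directly, for every discount factor `α ≤ 1` at
once, without compactness arguments.

Since `2 p < q`, the weight `2 ^ x` contracts in the mean by the factor `drift p q < 1` in one
step from any nonempty queue, whatever the control (`stepMean_two_pow_le`). Hence the dynamic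
programming operator with running cost reduced by a constant `β`, stopped when the queue becomes
empty, is a contraction in the norm weighted by `2 ^ x`, uniformly in `α ≤ 1`; its fixed point is
antitone in `β` and Lipschitz in `(α, β)` (`exists_isStoppedValue`, `IsStoppedValue.sub_le`). The
equation at the empty queue reads `β = min (α p u 1) lam`, where `u` is the fixed point. Its
right-hand side is continuous and antitone in `β`, so a solution exists
(`exists_isRelativeValue`), and it depends Lipschitz continuously on `α` at `α = 1`
(`IsRelativeValue.abs_sub_le`).

For `α < 1` the function `β / (1 - α) + u` solves the discounted equation, and a verification
argument identifies it with the discounted value function (`discountedValue_eq`): along an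
admissible control the mean of `2 ^ X_t` grows at most linearly, so that the remainder of the
telescoping sum vanishes. The infimum is attained by a feedback control, realized on a sequence of
independent innovations (`exists_isAdmissible_feedback`). Thus `V_α x - V_α 0 = u x` and `(1 - α)
V_α 0 = β`, and the limits follow from the Lipschitz dependence on `α`.

For monotonicity, a longer queue stays stochastically longer after one step (`monotone_stepMean`),
so value iteration preserves monotone functions. The limit `V` is therefore monotone, and the term
`C x` in the average cost equation makes it strictly monotone.
-/

noncomputable section

namespace ProcessorSharing

variable {p q C lam α α' β β' θ : ℝ}

/-! ### One step of the queue -/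

/-- Mean of `v` at the next queue length, from the queue length `x`, when an arrival occurs with
probability `θ`. The active mode has `θ = p` and the passive mode has `θ = 0`. -/
def stepMean (q θ : ℝ) (x : ℕ) (v : ℕ → ℝ) : ℝ :=
  ∑ d ∈ Finset.range (x + 1), depProb q x d * (θ * v (x + 1 - d) + (1 - θ) * v (x - d))

lemma div_natCast_mem_Icc (hq0 : 0 ≤ q) (hq1 : q ≤ 1) (x : ℕ) :
    q / (x : ℝ) ∈ Set.Icc (0 : ℝ) 1 := by
  refine ⟨by positivity, ?_⟩
  rcases Nat.eq_zero_or_pos x with rfl | hx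
  · simp
  · have : (1 : ℝ) ≤ x := by exact_mod_cast hx
    rw [div_le_one (by linarith)]; linarith

lemma depProb_nonneg (hq0 : 0 ≤ q) (hq1 : q ≤ 1) (x d : ℕ) : 0 ≤ depProb q x d := by
  obtain ⟨h0, h1⟩ := div_natCast_mem_Icc hq0 hq1 x
  have : 0 ≤ 1 - q / (x : ℝ) := by linarith
  unfold depProb; positivity

lemma depProb_eq_zero {x d : ℕ} (h : x < d) : depProb q x d = 0 := by
  simp [depProb, Nat.choose_eq_zero_of_lt h]

lemma sum_depProb_mul_pow (q r : ℝ) (x : ℕ) :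
    ∑ d ∈ Finset.range (x + 1), depProb q x d * r ^ (x - d)
      = (q / (x : ℝ) + r * (1 - q / (x : ℝ))) ^ x := by
  rw [add_pow]
  refine Finset.sum_congr rfl fun d _ => ?_
  rw [depProb, mul_pow]; ring

lemma sum_depProb (q : ℝ) (x : ℕ) : ∑ d ∈ Finset.range (x + 1), depProb q x d = 1 := by
  simpa using sum_depProb_mul_pow q 1 x

lemma stepMean_add (q θ : ℝ) (x : ℕ) (v w : ℕ → ℝ) :
    stepMean q θ x (fun k => v k + w k) = stepMean q θ x v + stepMean q θ x w := by
  simp only [stepMean, ← Finset.sum_add_distrib]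
  exact Finset.sum_congr rfl fun d _ => by ring

lemma stepMean_const_mul (q θ : ℝ) (x : ℕ) (a : ℝ) (v : ℕ → ℝ) :
    stepMean q θ x (fun k => a * v k) = a * stepMean q θ x v := by
  simp only [stepMean, Finset.mul_sum]
  exact Finset.sum_congr rfl fun d _ => by ring

lemma stepMean_const (q θ : ℝ) (x : ℕ) (a : ℝ) : stepMean q θ x (fun _ => a) = a := by
  have : stepMean q θ x (fun _ => a) = (∑ d ∈ Finset.range (x + 1), depProb q x d) * a := by
    rw [stepMean, Finset.sum_mul]
    exact Finset.sum_congr rfl fun d _ => by ring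
  rw [this, sum_depProb, one_mul]

lemma stepMean_mono (hq0 : 0 ≤ q) (hq1 : q ≤ 1) (hθ0 : 0 ≤ θ) (hθ1 : θ ≤ 1) (x : ℕ)
    {v w : ℕ → ℝ} (h : ∀ k, v k ≤ w k) : stepMean q θ x v ≤ stepMean q θ x w := by
  refine Finset.sum_le_sum fun d _ => mul_le_mul_of_nonneg_left ?_ (depProb_nonneg hq0 hq1 x d)
  have : 0 ≤ 1 - θ := by linarith
  gcongr <;> apply h

lemma abs_stepMean_le (hq0 : 0 ≤ q) (hq1 : q ≤ 1) (hθ0 : 0 ≤ θ) (hθ1 : θ ≤ 1) (x : ℕ)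
    {v w : ℕ → ℝ} (h : ∀ k, |v k| ≤ w k) : |stepMean q θ x v| ≤ stepMean q θ x w := by
  rw [abs_le]
  constructor
  · have := stepMean_mono hq0 hq1 hθ0 hθ1 x (v := fun k => (-1) * w k) (w := v)
      fun k => by linarith [(abs_le.1 (h k)).1]
    rw [stepMean_const_mul] at this
    linarith
  · exact stepMean_mono hq0 hq1 hθ0 hθ1 x fun k => (abs_le.1 (h k)).2

lemma stepMean_zero_left (q θ : ℝ) (v : ℕ → ℝ) :
    stepMean q θ 0 v = θ * v 1 + (1 - θ) * v 0 := by
  simp [stepMean, depProb]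

lemma stepMean_passive (q : ℝ) (x : ℕ) (v : ℕ → ℝ) :
    stepMean q 0 x v = ∑ d ∈ Finset.range (x + 1), depProb q x d * v (x - d) := by
  simp [stepMean]

/-! ### Geometric drift -/

/-- The factor by which the weight `2 ^ x` contracts, on average, in one step from `x ≥ 1`. -/
def drift (p q : ℝ) : ℝ := Real.exp (p - q / 2)

lemma drift_pos (p q : ℝ) : 0 < drift p q := Real.exp_pos _

lemma drift_lt_one (hpq : 2 * p < q) : drift p q < 1 := by
  rw [drift, Real.exp_lt_one_iff]; linarith

lemma stepMean_two_pow (q θ : ℝ) (x : ℕ) :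
    stepMean q θ x (fun k => 2 ^ k) = (1 + θ) * (2 - q / (x : ℝ)) ^ x := by
  have h : (2 - q / (x : ℝ)) ^ x = ∑ d ∈ Finset.range (x + 1), depProb q x d * 2 ^ (x - d) := by
    rw [sum_depProb_mul_pow]; congr 1; ring
  rw [h, stepMean, Finset.mul_sum]
  refine Finset.sum_congr rfl fun d hd => ?_
  rw [Nat.succ_sub (Finset.mem_range_succ_iff.1 hd), pow_succ]; ring

/-- Away from an empty queue the weight `2 ^ x` decreases geometrically in the mean, because
`(1 + p) (1 - q / (2 x)) ^ x ≤ exp (p - q / 2)`. -/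
lemma stepMean_two_pow_le (hq0 : 0 ≤ q) (hq1 : q ≤ 1) (hθ : θ ≤ p) {x : ℕ}
    (hx : x ≠ 0) : stepMean q θ x (fun k => 2 ^ k) ≤ drift p q * 2 ^ x := by
  have hx' : (x : ℝ) ≠ 0 := by exact_mod_cast hx
  have h1 : 1 + θ ≤ Real.exp p := by
    linarith [Real.add_one_le_exp p]
  have h2 : (1 - q / 2 / (x : ℝ)) ^ x ≤ Real.exp (-(q / 2)) := by
    have h := Real.add_one_le_exp (-(q / 2 / (x : ℝ)))
    have h0 : 0 ≤ 1 - q / 2 / (x : ℝ) := by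
      have := (div_natCast_mem_Icc (q := q / 2) (by linarith) (by linarith) x).2
      linarith
    calc (1 - q / 2 / (x : ℝ)) ^ x ≤ Real.exp (-(q / 2 / (x : ℝ))) ^ x :=
          pow_le_pow_left₀ h0 (by linarith) _
      _ = Real.exp (-(q / 2)) := by rw [← Real.exp_nat_mul]; congr 1; field_simp
  have h3 : (2 - q / (x : ℝ)) ^ x = (1 - q / 2 / (x : ℝ)) ^ x * 2 ^ x := by
    rw [← mul_pow]; congr 1; ring
  rw [stepMean_two_pow, h3, drift, sub_eq_add_neg p, Real.exp_add, ← mul_assoc]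
  have h4 : 0 ≤ (1 - q / 2 / (x : ℝ)) ^ x := by
    have := (div_natCast_mem_Icc (q := q / 2) (by linarith) (by linarith) x).2
    exact pow_nonneg (by linarith) _
  gcongr

lemma stepMean_two_pow_le_add_one (hq0 : 0 ≤ q) (hq1 : q ≤ 1) (hpq : 2 * p < q)
    (hθ : θ ≤ p) (x : ℕ) : stepMean q θ x (fun k => 2 ^ k) ≤ 2 ^ x + 1 := by
  rcases eq_or_ne x 0 with rfl | hx
  · rw [stepMean_zero_left]; norm_num; linarith
  · have h := stepMean_two_pow_le hq0 hq1 hθ hx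
    have : drift p q * 2 ^ x ≤ 1 * 2 ^ x := by gcongr; exact (drift_lt_one hpq).le
    linarith

/-! ### Stochastic monotonicity -/

/-- Mean of `v` under the binomial law with parameters `n` and `s`, computed by conditioning on the
trials one after the other. -/
def binomMean (s : ℝ) : ℕ → (ℕ → ℝ) → ℝ
  | 0, v => v 0
  | n + 1, v => binomMean s n (fun k => s * v (k + 1) + (1 - s) * v k)

lemma binomMean_mono {s : ℝ} (h0 : 0 ≤ s) (h1 : s ≤ 1) (n : ℕ) :
    ∀ {v w : ℕ → ℝ}, (∀ k, v k ≤ w k) → binomMean s n v ≤ binomMean s n w := by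
  induction n with
  | zero => intro v w h; exact h 0
  | succ n ih =>
    intro v w h
    have : 0 ≤ 1 - s := by linarith
    exact ih fun k => by gcongr <;> apply h

lemma binomMean_le_of_le {s t : ℝ} (h0 : 0 ≤ s) (hst : s ≤ t) (h1 : t ≤ 1) (n : ℕ) :
    ∀ {v : ℕ → ℝ}, Monotone v → binomMean s n v ≤ binomMean t n v := by
  induction n with
  | zero => intro v _; exact le_rfl
  | succ n ih =>
    intro v hv
    have ht : 0 ≤ 1 - t := by linarith
    have h0t : 0 ≤ t := h0.trans hst
    calc binomMean s n (fun k => s * v (k + 1) + (1 - s) * v k)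
        ≤ binomMean s n (fun k => t * v (k + 1) + (1 - t) * v k) := by
          refine binomMean_mono h0 (hst.trans h1) n fun k => ?_
          nlinarith [hv (Nat.le_succ k)]
      _ ≤ _ := by
          refine ih fun a b hab => ?_
          gcongr
          · exact hv (by omega)
          · exact hv hab

lemma binomMean_le_succ {s : ℝ} (h0 : 0 ≤ s) (h1 : s ≤ 1) (n : ℕ) {v : ℕ → ℝ} (hv : Monotone v) :
    binomMean s n v ≤ binomMean s (n + 1) v :=
  binomMean_mono h0 h1 n fun k => by nlinarith [hv (Nat.le_succ k)]

lemma sum_antidiagonal_eq_binomMean (s : ℝ) (n : ℕ) : ∀ v : ℕ → ℝ,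
    ∑ ij ∈ Finset.HasAntidiagonal.antidiagonal n,
        (n.choose ij.1 : ℝ) * ((1 - s) ^ ij.1 * s ^ ij.2 * v ij.2)
      = binomMean s n v := by
  induction n with
  | zero => intro v; simp [binomMean]
  | succ n ih =>
    intro v
    rw [Finset.sum_antidiagonal_choose_succ_mul (fun i j => (1 - s) ^ i * s ^ j * v j), binomMean,
      ← ih, ← Finset.sum_add_distrib]
    refine Finset.sum_congr rfl fun ij hij => ?_
    rw [← Nat.choose_symm_of_eq_add (Finset.HasAntidiagonal.mem_antidiagonal.1 hij).symm]
    ring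

lemma stepMean_eq_binomMean (q θ : ℝ) (x : ℕ) (v : ℕ → ℝ) :
    stepMean q θ x v
      = binomMean (1 - q / (x : ℝ)) x (fun k => θ * v (k + 1) + (1 - θ) * v k) := by
  rw [← sum_antidiagonal_eq_binomMean, Finset.Nat.sum_antidiagonal_eq_sum_range_succ_mk, stepMean]
  refine Finset.sum_congr rfl fun d hd => ?_
  rw [Nat.succ_sub (Finset.mem_range_succ_iff.1 hd), depProb]
  simp only [sub_sub_cancel]
  ring

/-- A longer queue remains stochastically longer after one step: it has more jobs, and each of them
stays with a larger probability. -/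
lemma monotone_stepMean (hq0 : 0 ≤ q) (hq1 : q ≤ 1) (hθ0 : 0 ≤ θ) (hθ1 : θ ≤ 1)
    {v : ℕ → ℝ} (hv : Monotone v) : Monotone fun x => stepMean q θ x v := by
  refine monotone_nat_of_le_succ fun x => ?_
  simp only [stepMean_eq_binomMean]
  have hw : Monotone fun k => θ * v (k + 1) + (1 - θ) * v k := by
    intro a b hab
    have : 0 ≤ 1 - θ := by linarith
    dsimp only
    gcongr
    · exact hv (by omega)
    · exact hv hab
  obtain ⟨a0, a1⟩ := div_natCast_mem_Icc hq0 hq1 x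
  obtain ⟨b0, b1⟩ := div_natCast_mem_Icc hq0 hq1 (x + 1)
  refine le_trans ?_ (binomMean_le_succ (by linarith) (by linarith) x hw)
  rcases Nat.eq_zero_or_pos x with rfl | hx
  · exact le_rfl
  · refine binomMean_le_of_le (by linarith) ?_ (by linarith) x hw
    have : (0 : ℝ) < x := by exact_mod_cast hx
    have : q / ((x + 1 : ℕ) : ℝ) ≤ q / (x : ℝ) := by
      push_cast; gcongr; linarith
    linarith

/-! ### The dynamic programming operator -/

/-- The dynamic programming operator with discount factor `α` and cost rate reduced by `β`. -/
def bellman (p q C lam α β : ℝ) (v : ℕ → ℝ) (x : ℕ) : ℝ :=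
  C * (x : ℝ) - β + min (α * stepMean q p x v) (lam + α * stepMean q 0 x v)

lemma solvesDPE_iff {V : ℕ → ℝ} :
    SolvesDPE p q C lam V β ↔ ∀ x, V x = bellman p q C lam 1 β V x := by
  simp only [SolvesDPE, bellman, stepMean_passive, one_mul]
  rfl

lemma strictMono_bellman (hC : 0 < C) (hq0 : 0 ≤ q) (hq1 : q ≤ 1) (hp0 : 0 ≤ p) (hp1 : p ≤ 1)
    (hα0 : 0 ≤ α) {v : ℕ → ℝ} (hv : Monotone v) : StrictMono (bellman p q C lam α β v) := by
  intro x y hxy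
  have h1 : stepMean q p x v ≤ stepMean q p y v := monotone_stepMean hq0 hq1 hp0 hp1 hv hxy.le
  have h2 : stepMean q 0 x v ≤ stepMean q 0 y v :=
    monotone_stepMean hq0 hq1 le_rfl zero_le_one hv hxy.le
  have h3 : C * (x : ℝ) < C * (y : ℝ) := by gcongr
  have h4 : min (α * stepMean q p x v) (lam + α * stepMean q 0 x v)
      ≤ min (α * stepMean q p y v) (lam + α * stepMean q 0 y v) := by
    gcongr
  unfold bellman
  linarith

/-- Comparison for the dynamic programming operator: if `f ≤ g + w`, and `b` bounds the discounted
mean of `w` after one step in either mode, the images differ by at most `b`, up to the change of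
`β`. -/
lemma bellman_le_add {β' b : ℝ} (hq0 : 0 ≤ q) (hq1 : q ≤ 1) (hp0 : 0 ≤ p) (hp1 : p ≤ 1)
    (hα0 : 0 ≤ α) {f g w : ℕ → ℝ} (h : ∀ k, f k ≤ g k + w k) {x : ℕ}
    (hb : ∀ θ, 0 ≤ θ → θ ≤ p → α * stepMean q θ x w ≤ b) :
    bellman p q C lam α β f x ≤ bellman p q C lam α β' g x + (β' - β) + b := by
  have key : ∀ θ, 0 ≤ θ → θ ≤ p → α * stepMean q θ x f ≤ α * stepMean q θ x g + b := by
    intro θ h0 h1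
    have := stepMean_mono hq0 hq1 h0 (h1.trans hp1) x h
    rw [stepMean_add] at this
    have := mul_le_mul_of_nonneg_left this hα0
    linarith [hb θ h0 h1]
  have h1 := key p hp0 le_rfl
  have h2 := key 0 le_rfl hp0
  have : min (α * stepMean q p x f) (lam + α * stepMean q 0 x f)
      ≤ min (α * stepMean q p x g) (lam + α * stepMean q 0 x g) + b := by
    rw [← min_add_add_right]
    exact min_le_min h1 (by linarith)
  unfold bellman
  linarith

/-! ### The problem stopped at the empty queue -/

/-- `u` grows at most like `2 ^ x`, vanishes at the empty queue, and solves the dynamic programming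
equation at every nonempty queue: it is the value of the problem with running cost reduced by `β`
that stops when the queue becomes empty. -/
structure IsStoppedValue (p q C lam α β : ℝ) (u : ℕ → ℝ) : Prop where
  bounded : ∃ M, 0 ≤ M ∧ ∀ x, |u x| ≤ M * 2 ^ x
  zero : u 0 = 0
  eq_bellman : ∀ x, x ≠ 0 → u x = bellman p q C lam α β u x

lemma mul_stepMean_le (hq0 : 0 ≤ q) (hq1 : q ≤ 1) (hα0 : 0 ≤ α) (hα1 : α ≤ 1)
    (hθ : θ ≤ p) {M : ℝ} (hM : 0 ≤ M) {x : ℕ} (hx : x ≠ 0) :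
    α * stepMean q θ x (fun k => M * 2 ^ k) ≤ drift p q * M * 2 ^ x := by
  have h := stepMean_two_pow_le hq0 hq1 hθ hx
  rw [stepMean_const_mul]
  have h0 : 0 ≤ M * (drift p q * 2 ^ x) :=
    mul_nonneg hM (mul_nonneg (drift_pos p q).le (by positivity))
  calc α * (M * stepMean q θ x (fun k => 2 ^ k)) ≤ α * (M * (drift p q * 2 ^ x)) := by gcongr
    _ ≤ 1 * (M * (drift p q * 2 ^ x)) := by gcongr
    _ = _ := by ring

lemma natCast_le_two_pow (x : ℕ) : (x : ℝ) ≤ 2 ^ x := by exact_mod_cast Nat.lt_two_pow_self.le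

lemma abs_bellman_le (hC : 0 < C) (hq0 : 0 ≤ q) (hq1 : q ≤ 1) (hpq : 2 * p < q) (hp0 : 0 ≤ p)
    (hα0 : 0 ≤ α) (hα1 : α ≤ 1) {M : ℝ} (hM : 0 ≤ M) {v : ℕ → ℝ} (hv : ∀ k, |v k| ≤ M * 2 ^ k)
    {x : ℕ} (hx : x ≠ 0) :
    |bellman p q C lam α β v x| ≤ (C + |β| + |lam| + M) * 2 ^ x := by
  have key : ∀ θ, 0 ≤ θ → θ ≤ p → |α * stepMean q θ x v| ≤ M * 2 ^ x := by
    intro θ h0 h1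
    have h2 := abs_stepMean_le hq0 hq1 h0 (by linarith : θ ≤ 1) x hv
    rw [abs_mul, abs_of_nonneg hα0]
    calc α * |stepMean q θ x v| ≤ α * stepMean q θ x (fun k => M * 2 ^ k) := by gcongr
      _ ≤ drift p q * M * 2 ^ x := mul_stepMean_le hq0 hq1 hα0 hα1 h1 hM hx
      _ ≤ 1 * M * 2 ^ x := by gcongr; exact (drift_lt_one hpq).le
      _ = _ := by ring
  obtain ⟨a1, a2⟩ := abs_le.1 (key p hp0 le_rfl)
  obtain ⟨b1, b2⟩ := abs_le.1 (key 0 le_rfl hp0)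
  have h1 : (1 : ℝ) ≤ 2 ^ x := one_le_pow₀ (by norm_num)
  have hx' := mul_le_mul_of_nonneg_left (natCast_le_two_pow x) hC.le
  have hx0 : 0 ≤ C * (x : ℝ) := by positivity
  have hβ : |β| ≤ |β| * 2 ^ x := le_mul_of_one_le_right (abs_nonneg _) h1
  have hl : |lam| ≤ |lam| * 2 ^ x := le_mul_of_one_le_right (abs_nonneg _) h1
  have hC' : 0 ≤ C * 2 ^ x := by positivity
  have := neg_abs_le β
  have := le_abs_self β
  have := neg_abs_le lam
  have := le_abs_self lam
  have hmin : -(|lam| + M * 2 ^ x) ≤ min (α * stepMean q p x v) (lam + α * stepMean q 0 x v) :=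
    le_min (by linarith [abs_nonneg lam]) (by linarith)
  have hmin' := min_le_left (α * stepMean q p x v) (lam + α * stepMean q 0 x v)
  unfold bellman
  rw [abs_le]
  constructor <;> linarith [abs_nonneg lam, abs_nonneg β]

/-- Stopping at the empty queue makes the dynamic programming operator a contraction for the norm
weighted by `2 ^ x`, uniformly in the discount factor, up to and including `α = 1`. -/
theorem exists_isStoppedValue (hC : 0 < C) (hq0 : 0 ≤ q) (hq1 : q ≤ 1) (hpq : 2 * p < q)
    (hp0 : 0 ≤ p) (lam : ℝ) (hα0 : 0 ≤ α) (hα1 : α ≤ 1) (β : ℝ) :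
    ∃ u, IsStoppedValue p q C lam α β u := by
  have hp1 : p ≤ 1 := by linarith
  have hbd : ∀ (u : BoundedContinuousFunction ℕ ℝ) (k : ℕ), |2 ^ k * u k| ≤ ‖u‖ * 2 ^ k := by
    intro u k
    rw [abs_mul, abs_of_pos (by positivity : (0 : ℝ) < 2 ^ k), mul_comm]
    gcongr
    exact u.norm_coe_le_norm k
  have hex : ∀ u : BoundedContinuousFunction ℕ ℝ, ∃ w : BoundedContinuousFunction ℕ ℝ,
      w 0 = 0 ∧ ∀ x, x ≠ 0 → 2 ^ x * w x = bellman p q C lam α β (fun k => 2 ^ k * u k) x := by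
    intro u
    refine ⟨BoundedContinuousFunction.ofNormedAddCommGroupDiscrete
      (fun x => if x = 0 then 0 else bellman p q C lam α β (fun k => 2 ^ k * u k) x / 2 ^ x)
      (C + |β| + |lam| + ‖u‖) fun x => ?_, by simp, fun x hx => ?_⟩
    · split_ifs with hx
      · rw [norm_zero]; positivity
      · rw [Real.norm_eq_abs, abs_div, abs_of_pos (by positivity : (0 : ℝ) < 2 ^ x),
          div_le_iff₀ (by positivity)]
        exact abs_bellman_le hC hq0 hq1 hpq hp0 hα0 hα1 (norm_nonneg u) (hbd u) hx
    · simp [hx]; field_simp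
  choose T hT0 hT using hex
  have hle : ∀ (u w : BoundedContinuousFunction ℕ ℝ) (x : ℕ),
      T u x ≤ T w x + drift p q * dist u w := by
    intro u w x
    rcases eq_or_ne x 0 with rfl | hx
    · rw [hT0, hT0, zero_add]
      exact mul_nonneg (drift_pos p q).le dist_nonneg
    · have h := bellman_le_add (C := C) (lam := lam) (β := β) (β' := β) hq0 hq1 hp0 hp1 hα0
        (f := fun k => 2 ^ k * u k) (g := fun k => 2 ^ k * w k)
        (w := fun k => dist u w * 2 ^ k) (fun k => by
          have h1 := u.dist_coe_le_dist (g := w) k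
          rw [Real.dist_eq] at h1
          have h2 := (le_abs_self _).trans h1
          have := mul_le_mul_of_nonneg_left h2 (by positivity : (0 : ℝ) ≤ 2 ^ k)
          linarith) (x := x)
        fun θ _ h1 => mul_stepMean_le hq0 hq1 hα0 hα1 h1 dist_nonneg hx
      rw [← hT u x hx, ← hT w x hx] at h
      have h0 : (0 : ℝ) < 2 ^ x := by positivity
      refine le_of_mul_le_mul_left ?_ h0
      linarith
  have hcontr : ContractingWith (NNReal.mk (drift p q) (drift_pos p q).le) T := by
    refine ⟨?_, LipschitzWith.of_dist_le_mul fun u w => ?_⟩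
    · exact_mod_cast drift_lt_one hpq
    · refine (BoundedContinuousFunction.dist_le
        (mul_nonneg (drift_pos p q).le dist_nonneg)).2 fun x => ?_
      rw [Real.dist_eq, abs_le]
      have h1 := hle u w x
      have h2 := hle w u x
      rw [dist_comm w u] at h2
      change -(drift p q * dist u w) ≤ _ ∧ _ ≤ drift p q * dist u w
      constructor <;> linarith
  have hfix : T (hcontr.fixedPoint T) = hcontr.fixedPoint T := hcontr.fixedPoint_isFixedPt
  set u := hcontr.fixedPoint T
  refine ⟨fun k => 2 ^ k * u k, ⟨‖u‖, norm_nonneg u, hbd u⟩, ?_, fun x hx => ?_⟩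
  · have := hT0 u
    rw [hfix] at this
    simp [this]
  · have := hT u x hx
    rwa [hfix] at this

/-- Maximum principle for the weight `2 ^ x`: a one-sided bound which improves by a factor
`drift p q`, up to `ε`, improves to `ε / (1 - drift p q)`. -/
lemma le_of_forall_improve (hpq : 2 * p < q) {w : ℕ → ℝ} {N ε : ℝ} (hN : 0 ≤ N) (hε : 0 ≤ ε)
    (hw : ∀ x, w x ≤ N * 2 ^ x)
    (h : ∀ M, 0 ≤ M → (∀ x, w x ≤ M * 2 ^ x) → ∀ x, w x ≤ (drift p q * M + ε) * 2 ^ x) (x : ℕ) :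
    w x ≤ ε / (1 - drift p q) * 2 ^ x := by
  have hd := drift_lt_one hpq
  have hd0 := drift_pos p q
  have hd' : 0 < 1 - drift p q := by linarith
  have key : ∀ n : ℕ, ∀ x, w x ≤ (drift p q ^ n * N + ε / (1 - drift p q)) * 2 ^ x := by
    intro n
    induction n with
    | zero =>
      intro x
      refine (hw x).trans ?_
      gcongr
      have : 0 ≤ ε / (1 - drift p q) := by positivity
      simpa using this
    | succ n ih =>
      intro x
      refine (h _ (by positivity) ih x).trans_eq ?_
      field_simp
      ring
  have hlim : Tendsto (fun n : ℕ => (drift p q ^ n * N + ε / (1 - drift p q)) * 2 ^ x) atTop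
      (𝓝 ((0 * N + ε / (1 - drift p q)) * 2 ^ x)) :=
    (((tendsto_pow_atTop_nhds_zero_of_lt_one hd0.le hd).mul_const N).add_const _).mul_const _
  rw [zero_mul, zero_add] at hlim
  exact ge_of_tendsto' hlim fun n => key n x

lemma bellman_le_of_discount (hq0 : 0 ≤ q) (hq1 : q ≤ 1) (hpq : 2 * p < q) (hp0 : 0 ≤ p)
    {M : ℝ} (hM : 0 ≤ M) {v : ℕ → ℝ} (hv : ∀ k, |v k| ≤ M * 2 ^ k) {x : ℕ} (hx : x ≠ 0) :
    bellman p q C lam α β v x ≤ bellman p q C lam α' β v x + |α - α'| * M * 2 ^ x := by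
  have key : ∀ θ, 0 ≤ θ → θ ≤ p →
      α * stepMean q θ x v ≤ α' * stepMean q θ x v + |α - α'| * M * 2 ^ x := by
    intro θ h0 h1
    have h2 := abs_stepMean_le hq0 hq1 h0 (by linarith : θ ≤ 1) x hv
    have h3 := mul_stepMean_le hq0 hq1 zero_le_one le_rfl h1 hM hx
    have h4 : drift p q * M * 2 ^ x ≤ 1 * M * 2 ^ x := by
      gcongr; exact (drift_lt_one hpq).le
    have h5 : |stepMean q θ x v| ≤ M * 2 ^ x := by linarith
    have h6 : (α - α') * stepMean q θ x v ≤ |α - α'| * (M * 2 ^ x) :=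
      (le_abs_self _).trans ((abs_mul _ _).trans_le (by gcongr))
    linarith
  have h1 := key p hp0 le_rfl
  have h2 := key 0 le_rfl hp0
  have : min (α * stepMean q p x v) (lam + α * stepMean q 0 x v)
      ≤ min (α' * stepMean q p x v) (lam + α' * stepMean q 0 x v) + |α - α'| * M * 2 ^ x := by
    rw [← min_add_add_right]
    exact min_le_min h1 (by linarith)
  unfold bellman
  linarith

/-- The stopped value is antitone in `β` and Lipschitz in `(α, β)`. The weighted bound `M` is needed
for only one of the two functions. -/
theorem IsStoppedValue.sub_le (hq0 : 0 ≤ q) (hq1 : q ≤ 1) (hpq : 2 * p < q) (hp0 : 0 ≤ p)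
    (hα0 : 0 ≤ α) (hα1 : α ≤ 1) (hα0' : 0 ≤ α') (hα1' : α' ≤ 1) {u u' : ℕ → ℝ}
    (hu : IsStoppedValue p q C lam α β u) (hu' : IsStoppedValue p q C lam α' β' u') {M δ : ℝ}
    (hM : 0 ≤ M) (huM : (∀ k, |u k| ≤ M * 2 ^ k) ∨ ∀ k, |u' k| ≤ M * 2 ^ k) (hδ : 0 ≤ δ)
    (hβ : β' - β ≤ δ) (x : ℕ) :
    u x - u' x ≤ (δ + |α - α'| * M) / (1 - drift p q) * 2 ^ x := by
  have hp1 : p ≤ 1 := by linarith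
  obtain ⟨N, hN, huN⟩ := hu.bounded
  obtain ⟨N', hN', huN'⟩ := hu'.bounded
  refine le_of_forall_improve (w := fun x => u x - u' x) hpq (add_nonneg hN hN') (by positivity)
    (fun x => ?_) (fun K hK hw x => ?_) x
  · have h1 := (abs_le.1 (huN x)).2
    have h2 := (abs_le.1 (huN' x)).1
    linarith
  · have hd0 := drift_pos p q
    rcases eq_or_ne x 0 with rfl | hx
    · rw [hu.zero, hu'.zero, sub_zero]
      positivity
    · have step : ∀ a, 0 ≤ a → a ≤ 1 → bellman p q C lam a β u x
          ≤ bellman p q C lam a β' u' x + (β' - β) + drift p q * K * 2 ^ x := fun a h0 h1 =>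
        bellman_le_add hq0 hq1 hp0 hp1 h0 (w := fun k => K * 2 ^ k)
          (fun k => by linarith [hw k]) fun θ _ hθ => mul_stepMean_le hq0 hq1 h0 h1 hθ hK hx
      have h1 : (1 : ℝ) ≤ 2 ^ x := one_le_pow₀ (by norm_num)
      have hδ' : δ ≤ δ * 2 ^ x := le_mul_of_one_le_right hδ h1
      rw [hu.eq_bellman x hx, hu'.eq_bellman x hx]
      rcases huM with h | h
      · have h2 := bellman_le_of_discount (C := C) (lam := lam) (α := α) (α' := α') (β := β)
          hq0 hq1 hpq hp0 hM h hx
        linarith [step α' hα0' hα1']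
      · have h2 := bellman_le_of_discount (C := C) (lam := lam) (α := α) (α' := α') (β := β')
          hq0 hq1 hpq hp0 hM h hx
        linarith [step α hα0 hα1]

/-! ### Relative values -/

/-- `u` and `β` solve the relative dynamic programming equation with discount factor `α`, where `u`
is normalized at the empty queue and grows at most like `2 ^ x`. -/
structure IsRelativeValue (p q C lam α β : ℝ) (u : ℕ → ℝ) : Prop where
  bounded : ∃ M, 0 ≤ M ∧ ∀ x, |u x| ≤ M * 2 ^ x
  zero : u 0 = 0
  eq_bellman : ∀ x, u x = bellman p q C lam α β u x

lemma IsRelativeValue.isStoppedValue {u : ℕ → ℝ} (h : IsRelativeValue p q C lam α β u) :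
    IsStoppedValue p q C lam α β u :=
  ⟨h.bounded, h.zero, fun x _ => h.eq_bellman x⟩

lemma bellman_zero {u : ℕ → ℝ} (h : u 0 = 0) :
    bellman p q C lam α β u 0 = -β + min (α * (p * u 1)) lam := by
  simp [bellman, stepMean_zero_left, h]

lemma IsRelativeValue.eq_min {u : ℕ → ℝ} (h : IsRelativeValue p q C lam α β u) :
    β = min (α * (p * u 1)) lam := by
  have := h.eq_bellman 0
  rw [bellman_zero h.zero, h.zero] at this
  linarith

/-- The equation at the empty queue selects `β`: the stopped value is continuous and antitone in
`β`, so that the intermediate value theorem applies. -/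
theorem exists_isRelativeValue (hC : 0 < C) (hq0 : 0 ≤ q) (hq1 : q ≤ 1) (hpq : 2 * p < q)
    (hp0 : 0 ≤ p) (lam : ℝ) (hα0 : 0 ≤ α) (hα1 : α ≤ 1) :
    ∃ β u, IsRelativeValue p q C lam α β u := by
  choose U hU using exists_isStoppedValue hC hq0 hq1 hpq hp0 lam hα0 hα1
  have hd : 0 < 1 - drift p q := by linarith [drift_lt_one hpq]
  have hle : ∀ b b' δ, 0 ≤ δ → b' - b ≤ δ → U b 1 - U b' 1 ≤ δ * (2 / (1 - drift p q)) := by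
    intro b b' δ hδ hb
    obtain ⟨M, hM, hMu⟩ := (hU b).bounded
    have := (hU b).sub_le hq0 hq1 hpq hp0 hα0 hα1 hα0 hα1 (hU b') hM (Or.inl hMu) hδ hb 1
    rw [sub_self, abs_zero, zero_mul, add_zero, pow_one] at this
    calc _ ≤ _ := this
      _ = _ := by ring
  have hcont : Continuous fun b => U b 1 := by
    refine (LipschitzWith.of_dist_le_mul (K := NNReal.mk (2 / (1 - drift p q)) (by positivity))
      fun b b' => ?_).continuous
    rw [Real.dist_eq, Real.dist_eq, abs_le, NNReal.coe_mk]
    have h1 := hle b b' |b - b'| (abs_nonneg _) (by rw [abs_sub_comm]; exact le_abs_self _)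
    have h2 := hle b' b |b - b'| (abs_nonneg _) (le_abs_self _)
    constructor <;> linarith
  let F : ℝ → ℝ := fun b => -b + min (α * (p * U b 1)) lam
  have hF : Continuous F := by fun_prop
  set b₀ := min (α * (p * U lam 1)) lam
  have hb₀ : b₀ ≤ lam := min_le_right _ _
  have h1 : F lam ≤ 0 := by
    have : min (α * (p * U lam 1)) lam ≤ lam := min_le_right _ _
    simp only [F]; linarith
  have h2 : 0 ≤ F b₀ := by
    have h3 := hle lam b₀ 0 le_rfl (by linarith)
    have h4 : U lam 1 ≤ U b₀ 1 := by linarith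
    have h5 : b₀ ≤ min (α * (p * U b₀ 1)) lam := by
      simp only [b₀]
      gcongr
    simp only [F]; linarith
  obtain ⟨b, -, hb⟩ := intermediate_value_Icc' hb₀ hF.continuousOn ⟨h1, h2⟩
  refine ⟨b, U b, (hU b).bounded, (hU b).zero, fun x => ?_⟩
  rcases eq_or_ne x 0 with rfl | hx
  · rw [bellman_zero (hU b).zero, (hU b).zero]; exact hb.symm
  · exact (hU b).eq_bellman x hx

/-- Relative values depend Lipschitz continuously on the discount factor at `α = 1`. -/
theorem IsRelativeValue.abs_sub_le (hq0 : 0 ≤ q) (hq1 : q ≤ 1) (hpq : 2 * p < q) (hp0 : 0 ≤ p)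
    {u : ℕ → ℝ} (hu : IsRelativeValue p q C lam 1 β u) :
    ∃ K, ∀ α β' u', 0 ≤ α → α ≤ 1 → IsRelativeValue p q C lam α β' u' →
      |β' - β| ≤ K * (1 - α) ∧ ∀ x, |u' x - u x| ≤ K * (1 - α) * 2 ^ x := by
  obtain ⟨M, hM, huM⟩ := hu.bounded
  have hp1 : p ≤ 1 := by linarith
  have hd : 0 < 1 - drift p q := by linarith [drift_lt_one hpq]
  set A := M / (1 - drift p q) * 2 + |u 1| with hA
  have hA0 : 0 ≤ A := by positivity
  refine ⟨A + (A + M) / (1 - drift p q), fun α β' u' hα0 hα1 hu' => ?_⟩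
  have h1α : 0 ≤ 1 - α := by linarith
  have e1 : |(1 : ℝ) - α| = 1 - α := abs_of_nonneg h1α
  have e2 : |α - 1| = 1 - α := by rw [abs_sub_comm, e1]
  have up : ∀ δ, 0 ≤ δ → β - β' ≤ δ → ∀ x,
      u' x - u x ≤ (δ + (1 - α) * M) / (1 - drift p q) * 2 ^ x := fun δ hδ hb x => by
    have := hu'.isStoppedValue.sub_le hq0 hq1 hpq hp0 hα0 hα1 zero_le_one le_rfl
      hu.isStoppedValue hM (Or.inr huM) hδ hb x
    rwa [e2] at this
  have down : ∀ δ, 0 ≤ δ → β' - β ≤ δ → ∀ x,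
      u x - u' x ≤ (δ + (1 - α) * M) / (1 - drift p q) * 2 ^ x := fun δ hδ hb x => by
    have := hu.isStoppedValue.sub_le hq0 hq1 hpq hp0 zero_le_one le_rfl hα0 hα1
      hu'.isStoppedValue hM (Or.inl huM) hδ hb x
    rwa [e1] at this
  have hpu : |(1 - α) * (p * u 1)| ≤ (1 - α) * |u 1| := by
    rw [abs_mul, abs_of_nonneg h1α, abs_mul, abs_of_nonneg hp0]
    gcongr
    exact mul_le_of_le_one_left (abs_nonneg _) hp1
  obtain ⟨hpu1, hpu2⟩ := abs_le.1 hpu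
  have hsmall : ∀ y, y ≤ (0 + (1 - α) * M) / (1 - drift p q) * 2 ^ 1 →
      α * (p * y) ≤ (1 - α) * (M / (1 - drift p q) * 2) := by
    intro y hy
    have h0 : 0 ≤ (1 - α) * (M / (1 - drift p q) * 2) := by positivity
    have hy' : y ≤ (1 - α) * (M / (1 - drift p q) * 2) := by
      refine hy.trans_eq ?_
      ring
    calc α * (p * y) = (α * p) * y := by ring
      _ ≤ (α * p) * ((1 - α) * (M / (1 - drift p q) * 2)) := by gcongr
      _ ≤ 1 * ((1 - α) * (M / (1 - drift p q) * 2)) := by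
        gcongr
        exact mul_le_one₀ hα1 hp0 hp1
      _ = _ := one_mul _
  -- A change of `β` moves the two sides of `β = min (α p u 1) lam` in opposite directions, so that
  -- only the change of `α` contributes to `|β' - β|`.
  have hβ : |β' - β| ≤ A * (1 - α) := by
    rw [abs_le]
    have r := hu.eq_min
    have r' := hu'.eq_min
    rw [one_mul] at r
    constructor
    · rcases le_total β β' with h | h
      · have : 0 ≤ A * (1 - α) := by positivity
        linarith
      · have h1 := hsmall _ (down 0 le_rfl (by linarith) 1)
        have h2 : min (p * u 1) lam ≤ min (α * (p * u' 1)) lam + A * (1 - α) := by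
          rw [← min_add_add_right]
          refine min_le_min ?_ (by linarith [mul_nonneg hA0 h1α])
          rw [hA]; linarith
        linarith
    · rcases le_total β β' with h | h
      · have h1 := hsmall _ (up 0 le_rfl (by linarith) 1)
        have h2 : min (α * (p * u' 1)) lam ≤ min (p * u 1) lam + A * (1 - α) := by
          rw [← min_add_add_right]
          refine min_le_min ?_ (by linarith [mul_nonneg hA0 h1α])
          rw [hA]; linarith
        linarith
      · have : 0 ≤ A * (1 - α) := by positivity
        linarith
  have hAM : 0 ≤ (A + M) / (1 - drift p q) * (1 - α) := by positivity
  refine ⟨by linarith, fun x => ?_⟩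
  have h1 := up (A * (1 - α)) (by positivity) (by linarith [(abs_le.1 hβ).1]) x
  have h2 := down (A * (1 - α)) (by positivity) (by linarith [(abs_le.1 hβ).2]) x
  have h3 : (A * (1 - α) + (1 - α) * M) / (1 - drift p q) * 2 ^ x
      ≤ (A + (A + M) / (1 - drift p q)) * (1 - α) * 2 ^ x := by
    gcongr
    have : (A * (1 - α) + (1 - α) * M) / (1 - drift p q) = (A + M) / (1 - drift p q) * (1 - α) := by
      ring
    rw [this]
    linarith [mul_nonneg hA0 h1α]
  rw [abs_le]
  constructor <;> linarith

/-! ### Expectations along an admissible control -/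

lemma integrable_and_integral_of_finset {Ω ι : Type*} [MeasurableSpace Ω] [MeasurableSpace ι]
    [MeasurableSingletonClass ι] {P : Measure Ω} [IsFiniteMeasure P] {Z : Ω → ι}
    (hZ : Measurable Z) (s : Finset ι) (hs : ∀ ω, Z ω ∈ s) (G : ι → ℝ) :
    Integrable (fun ω => G (Z ω)) P ∧
      ∫ ω, G (Z ω) ∂P = ∑ z ∈ s, P.real (Z ⁻¹' {z}) * G z := by
  classical
  have hG : (fun ω => G (Z ω)) = fun ω => ∑ z ∈ s, (Z ⁻¹' {z}).indicator (fun _ => G z) ω := by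
    funext ω
    rw [Finset.sum_eq_single_of_mem (Z ω) (hs ω)]
    · simp
    · intro z _ hz
      exact Set.indicator_of_notMem (fun h => hz (by simpa using h.symm)) _
  have hm : ∀ z, MeasurableSet (Z ⁻¹' {z}) := fun z => hZ (measurableSet_singleton z)
  have hi : ∀ z ∈ s, Integrable ((Z ⁻¹' {z}).indicator fun _ => G z) P := fun z _ =>
    (integrable_const _).indicator (hm z)
  rw [hG]
  refine ⟨integrable_finsetSum _ hi, ?_⟩
  rw [integral_finsetSum _ hi]
  refine Finset.sum_congr rfl fun z _ => ?_
  rw [integral_indicator_const _ (hm z), smul_eq_mul]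

section Admissible

variable {Ω : Type} [MeasurableSpace Ω] {P : Measure Ω} {X D ξ ν : ℕ → Ω → ℕ} {x : ℕ}

lemma IsAdmissible.control_mul_arrival_le_one (h : IsAdmissible p q x P X D ξ ν) (t : ℕ) (ω : Ω) :
    ν t ω * ξ (t + 1) ω ≤ 1 := by
  rcases h.control_mem t ω with h1 | h1 <;> rcases h.arrival_mem (t + 1) ω with h2 | h2 <;>
    simp [h1, h2]

lemma IsAdmissible.queue_le (h : IsAdmissible p q x P X D ξ ν) (t : ℕ) (ω : Ω) :
    X t ω ≤ x + t := by
  induction t with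
  | zero => rw [h.initial]; rfl
  | succ t ih =>
    have h1 := h.dynamics t ω
    have h2 := h.control_mul_arrival_le_one t ω
    omega

lemma IsAdmissible.control_mem_range (h : IsAdmissible p q x P X D ξ ν) (t : ℕ) (ω : Ω) :
    ν t ω ∈ Finset.range 2 := by
  rcases h.control_mem t ω with h | h <;> simp [h]

lemma IsAdmissible.integral_eq_sum (h : IsAdmissible p q x P X D ξ ν) (t : ℕ) (G : ℕ × ℕ → ℝ) :
    Integrable (fun ω => G (X t ω, ν t ω)) P ∧ ∫ ω, G (X t ω, ν t ω) ∂P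
      = ∑ z ∈ Finset.range (x + t + 1) ×ˢ Finset.range 2,
          P.real {ω | X t ω = z.1 ∧ ν t ω = z.2} * G z := by
  have := h.isProbabilityMeasure
  have h1 := integrable_and_integral_of_finset (P := P)
    ((h.measurable_queue t).prodMk (h.measurable_control t))
    (Finset.range (x + t + 1) ×ˢ Finset.range 2) (fun ω => Finset.mem_product.2
      ⟨Finset.mem_range_succ_iff.2 (h.queue_le t ω), h.control_mem_range t ω⟩) G
  refine ⟨h1.1, h1.2.trans (Finset.sum_congr rfl fun z _ => ?_)⟩
  congr 2
  ext ω
  simp [Prod.ext_iff]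

lemma sum_depProb_mul_arrProb (p q : ℝ) {k a N : ℕ} (hk : k < N) (ha : a ∈ Finset.range 2)
    (v : ℕ → ℝ) :
    ∑ z ∈ Finset.range N ×ˢ Finset.range 2,
        depProb q k z.1 * arrProb p z.2 * v (k + a * z.2 - z.1)
      = stepMean q ((a : ℝ) * p) k v := by
  rw [Finset.sum_product, stepMean]
  symm
  refine Finset.sum_subset_zero_on_sdiff (Finset.range_subset_range.2 hk) (fun d hd => ?_)
    fun d _ => ?_
  · have : k < d := by simpa using (Finset.mem_sdiff.1 hd).2
    simp [depProb_eq_zero this]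
  · rw [Finset.sum_range_succ, Finset.sum_range_one]
    rcases (by simpa [Finset.range_add_one] using ha : a = 1 ∨ a = 0) with rfl | rfl
    · simp [arrProb]; ring
    · simp [arrProb]; ring

/-- The Markov property in expectation: given the present queue length and control, the next queue
length has the law described by `stepMean`. -/
lemma IsAdmissible.integral_queue_succ (h : IsAdmissible p q x P X D ξ ν) (t : ℕ) (v : ℕ → ℝ) :
    ∫ ω, v (X (t + 1) ω) ∂P = ∫ ω, stepMean q ((ν t ω : ℝ) * p) (X t ω) v ∂P := by
  have := h.isProbabilityMeasure
  rw [(h.integral_eq_sum t fun z => stepMean q ((z.2 : ℝ) * p) z.1 v).2]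
  have hX : ∀ ω, v (X (t + 1) ω) = v (X t ω + ν t ω * ξ (t + 1) ω - D (t + 1) ω) := by
    intro ω
    rw [← h.dynamics t ω, Nat.add_sub_cancel]
  have hD : ∀ ω, D (t + 1) ω < x + t + 2 := by
    intro ω
    have h1 := h.dynamics t ω
    have h2 := h.control_mul_arrival_le_one t ω
    have := h.queue_le t ω
    omega
  have hξ : ∀ ω, ξ (t + 1) ω ∈ Finset.range 2 := by
    intro ω
    rcases h.arrival_mem (t + 1) ω with h | h <;> simp [h]
  have h1 := (integrable_and_integral_of_finset (P := P)
    (((h.measurable_queue t).prodMk (h.measurable_control t)).prodMk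
      ((h.measurable_departure (t + 1)).prodMk (h.measurable_arrival (t + 1))))
    ((Finset.range (x + t + 1) ×ˢ Finset.range 2) ×ˢ
      (Finset.range (x + t + 2) ×ˢ Finset.range 2))
    (fun ω => Finset.mem_product.2 ⟨Finset.mem_product.2
      ⟨Finset.mem_range_succ_iff.2 (h.queue_le t ω), h.control_mem_range t ω⟩,
      Finset.mem_product.2 ⟨Finset.mem_range.2 (hD ω), hξ ω⟩⟩)
    fun z => v (z.1.1 + z.1.2 * z.2.2 - z.2.1)).2
  simp only [hX]
  rw [h1, Finset.sum_product]
  refine Finset.sum_congr rfl fun z hz => ?_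
  obtain ⟨hz1, hz2⟩ := Finset.mem_product.1 hz
  rw [← sum_depProb_mul_arrProb p q (N := x + t + 2)
    (by have := Finset.mem_range.1 hz1; omega) hz2, Finset.mul_sum]
  refine Finset.sum_congr rfl fun w _ => ?_
  have h2 := h.conditional_law t {g | g.2.2 (Fin.last t) = z.2} z.1 w.1 w.2
  have e1 : {ω | history X D ξ ν t ω ∈ {g | g.2.2 (Fin.last t) = z.2} ∧ X t ω = z.1 ∧
      D (t + 1) ω = w.1 ∧ ξ (t + 1) ω = w.2}
      = (fun ω => ((X t ω, ν t ω), (D (t + 1) ω, ξ (t + 1) ω))) ⁻¹' {(z, w)} := by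
    ext ω
    simp only [history, Set.mem_ofPred_eq, Set.mem_preimage, Set.mem_singleton_iff, Prod.ext_iff,
      Fin.val_last]
    tauto
  have e2 : {ω | history X D ξ ν t ω ∈ {g | g.2.2 (Fin.last t) = z.2} ∧ X t ω = z.1}
      = {ω | X t ω = z.1 ∧ ν t ω = z.2} := by
    ext ω
    simp only [history, Set.mem_ofPred_eq, Fin.val_last]
    tauto
  rw [e1, e2] at h2
  rw [h2]
  ring

lemma IsAdmissible.integrable_queue (h : IsAdmissible p q x P X D ξ ν) (t : ℕ) (v : ℕ → ℝ) :
    Integrable (fun ω => v (X t ω)) P :=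
  (h.integral_eq_sum t fun z => v z.1).1

lemma IsAdmissible.integral_two_pow_le (hq0 : 0 ≤ q) (hq1 : q ≤ 1) (hp0 : 0 ≤ p)
    (hpq : 2 * p < q) (h : IsAdmissible p q x P X D ξ ν) (t : ℕ) :
    ∫ ω, (2 : ℝ) ^ X t ω ∂P ≤ 2 ^ x + t := by
  have := h.isProbabilityMeasure
  induction t with
  | zero => simp [h.initial]
  | succ t ih =>
    rw [h.integral_queue_succ t fun k => 2 ^ k]
    calc ∫ ω, stepMean q ((ν t ω : ℝ) * p) (X t ω) (fun k => 2 ^ k) ∂P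
        ≤ ∫ ω, ((2 : ℝ) ^ X t ω + 1) ∂P := by
          refine integral_mono
            (h.integral_eq_sum t fun z => stepMean q ((z.2 : ℝ) * p) z.1 fun k => 2 ^ k).1
            ((h.integrable_queue t fun k => 2 ^ k).add (integrable_const 1)) fun ω => ?_
          refine stepMean_two_pow_le_add_one hq0 hq1 hpq ?_ _
          rcases h.control_mem t ω with h | h <;> simp [h, hp0]
      _ = ∫ ω, (2 : ℝ) ^ X t ω ∂P + 1 := by
          rw [integral_add (h.integrable_queue t fun k => 2 ^ k) (integrable_const 1)]; simp
      _ ≤ _ := by push_cast; linarith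

lemma IsAdmissible.tendsto_pow_mul_integral (hq0 : 0 ≤ q) (hq1 : q ≤ 1) (hp0 : 0 ≤ p)
    (hpq : 2 * p < q) (hα0 : 0 ≤ α) (hα1 : α < 1) (h : IsAdmissible p q x P X D ξ ν)
    {v : ℕ → ℝ} {M : ℝ} (hM : 0 ≤ M) (hv : ∀ k, |v k| ≤ M * 2 ^ k) :
    Tendsto (fun n : ℕ => α ^ n * ∫ ω, v (X n ω) ∂P) atTop (𝓝 0) := by
  have hb : ∀ n : ℕ, |α ^ n * ∫ ω, v (X n ω) ∂P| ≤ M * (2 ^ x * α ^ n + n * α ^ n) := by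
    intro n
    have h1 : |∫ ω, v (X n ω) ∂P| ≤ M * (2 ^ x + n) := by
      calc |∫ ω, v (X n ω) ∂P| ≤ ∫ ω, |v (X n ω)| ∂P := abs_integral_le_integral_abs
        _ ≤ ∫ ω, M * 2 ^ X n ω ∂P :=
          integral_mono (h.integrable_queue n v).abs (h.integrable_queue n fun k => M * 2 ^ k)
            fun ω => hv _
        _ = M * ∫ ω, 2 ^ X n ω ∂P := integral_const_mul _ _
        _ ≤ _ := by gcongr; exact h.integral_two_pow_le hq0 hq1 hp0 hpq n
    rw [abs_mul, abs_of_nonneg (pow_nonneg hα0 n)]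
    calc α ^ n * |∫ ω, v (X n ω) ∂P| ≤ α ^ n * (M * (2 ^ x + n)) := by gcongr
      _ = _ := by ring
  refine squeeze_zero_norm hb ?_
  have h1 := tendsto_pow_atTop_nhds_zero_of_lt_one hα0 hα1
  have h2 := tendsto_self_mul_const_pow_of_lt_one hα0 hα1
  simpa using ((h1.const_mul (2 ^ x)).add h2).const_mul M

lemma IsAdmissible.abs_cost_le (hC : 0 < C) (h : IsAdmissible p q x P X D ξ ν) (t : ℕ) (ω : Ω) :
    |cost C lam (X t ω) (ν t ω)| ≤ C * (x + t) + |lam| := by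
  have h1 : (X t ω : ℝ) ≤ x + t := by exact_mod_cast h.queue_le t ω
  have h2 := mul_le_mul_of_nonneg_left h1 hC.le
  have h0 : 0 ≤ C * (X t ω : ℝ) := by positivity
  have := neg_abs_le lam
  have := le_abs_self lam
  unfold cost
  rw [abs_le]
  rcases h.control_mem t ω with h | h <;> rw [h] <;> constructor <;> push_cast <;> linarith

lemma IsAdmissible.hasSum_discountedCost (hC : 0 < C) (hα0 : 0 ≤ α) (hα1 : α < 1)
    (h : IsAdmissible p q x P X D ξ ν) :
    HasSum (fun t : ℕ => α ^ t * ∫ ω, cost C lam (X t ω) (ν t ω) ∂P)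
      (discountedCost C lam α P X ν) := by
  have := h.isProbabilityMeasure
  have hint : ∀ t : ℕ, Integrable (fun ω => α ^ t * cost C lam (X t ω) (ν t ω)) P := fun t =>
    (h.integral_eq_sum t fun z => α ^ t * cost C lam z.1 z.2).1
  have hsum : Summable fun t : ℕ => (C * (x + t) + |lam|) * α ^ t := by
    have hα : ‖α‖ < 1 := by rwa [Real.norm_of_nonneg hα0]
    have h1 := (summable_geometric_of_lt_one hα0 hα1).mul_left (C * x + |lam|)
    have h2 := (summable_pow_mul_geometric_of_norm_lt_one 1 hα).mul_left C
    refine (h1.add h2).congr fun t => ?_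
    rw [pow_one]; ring
  have hnorm : Summable fun t : ℕ => ∫ ω, ‖α ^ t * cost C lam (X t ω) (ν t ω)‖ ∂P := by
    refine hsum.of_nonneg_of_le (fun t => integral_nonneg fun ω => norm_nonneg _) fun t => ?_
    calc ∫ ω, ‖α ^ t * cost C lam (X t ω) (ν t ω)‖ ∂P
        ≤ ∫ _, (C * (x + t) + |lam|) * α ^ t ∂P := by
          refine integral_mono (hint t).norm (integrable_const _) fun ω => ?_
          dsimp only
          rw [norm_mul, Real.norm_of_nonneg (pow_nonneg hα0 t), mul_comm]
          gcongr
          exact h.abs_cost_le hC t ω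
      _ = _ := by simp
  have := hasSum_integral_of_summable_integral_norm hint hnorm
  simp only [integral_const_mul] at this
  exact this

end Admissible

/-- Telescoping of the one-step inequalities `e t ≤ c t + α e (t + 1)`. -/
lemma le_of_hasSum_of_step {e c : ℕ → ℝ} {J : ℝ} (hα0 : 0 ≤ α)
    (hstep : ∀ t, e t ≤ c t + α * e (t + 1)) (hJ : HasSum (fun t => α ^ t * c t) J)
    (he : Tendsto (fun n => α ^ n * e n) atTop (𝓝 0)) : e 0 ≤ J := by
  have key : ∀ n, e 0 ≤ ∑ t ∈ Finset.range n, α ^ t * c t + α ^ n * e n := by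
    intro n
    induction n with
    | zero => simp
    | succ n ih =>
      have := mul_le_mul_of_nonneg_left (hstep n) (pow_nonneg hα0 n)
      rw [Finset.sum_range_succ, pow_succ]
      linarith
  have := hJ.tendsto_sum_nat.add he
  rw [add_zero] at this
  exact ge_of_tendsto' this key

/-! ### Verification -/

section Verification

variable {Ω : Type} [MeasurableSpace Ω] {P : Measure Ω} {X D ξ ν : ℕ → Ω → ℕ} {x : ℕ}
  {v : ℕ → ℝ} {M : ℝ}

/-- A solution of the discounted dynamic programming equation bounds every discounted cost from
below. -/
lemma IsAdmissible.le_discountedCost (hC : 0 < C) (hq0 : 0 ≤ q) (hq1 : q ≤ 1) (hp0 : 0 ≤ p)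
    (hpq : 2 * p < q) (hα0 : 0 ≤ α) (hα1 : α < 1) (h : IsAdmissible p q x P X D ξ ν)
    (hM : 0 ≤ M) (hv : ∀ k, |v k| ≤ M * 2 ^ k)
    (hle : ∀ k a, a = 0 ∨ a = 1 → v k ≤ cost C lam k a + α * stepMean q ((a : ℝ) * p) k v) :
    v x ≤ discountedCost C lam α P X ν := by
  have := h.isProbabilityMeasure
  have h0 : ∫ ω, v (X 0 ω) ∂P = v x := by simp [h.initial]
  rw [← h0]
  refine le_of_hasSum_of_step (e := fun t => ∫ ω, v (X t ω) ∂P) hα0 (fun t => ?_)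
    (h.hasSum_discountedCost hC hα0 hα1)
    (h.tendsto_pow_mul_integral hq0 hq1 hp0 hpq hα0 hα1 hM hv)
  have i1 := (h.integral_eq_sum t fun z => cost C lam z.1 z.2).1
  have i2 := (h.integral_eq_sum t fun z => α * stepMean q ((z.2 : ℝ) * p) z.1 v).1
  rw [h.integral_queue_succ t v, ← integral_const_mul, ← integral_add i1 i2]
  exact integral_mono (h.integrable_queue t v) (i1.add i2)
    fun ω => hle _ _ (h.control_mem t ω)

/-- A control that attains the minimum in the discounted dynamic programming equation attains the
bound. -/
lemma IsAdmissible.eq_discountedCost (hC : 0 < C) (hq0 : 0 ≤ q) (hq1 : q ≤ 1) (hp0 : 0 ≤ p)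
    (hpq : 2 * p < q) (hα0 : 0 ≤ α) (hα1 : α < 1) (h : IsAdmissible p q x P X D ξ ν)
    (hM : 0 ≤ M) (hv : ∀ k, |v k| ≤ M * 2 ^ k)
    (heq : ∀ t ω, v (X t ω)
      = cost C lam (X t ω) (ν t ω) + α * stepMean q ((ν t ω : ℝ) * p) (X t ω) v) :
    v x = discountedCost C lam α P X ν := by
  have := h.isProbabilityMeasure
  have h0 : ∫ ω, v (X 0 ω) ∂P = v x := by simp [h.initial]
  have hstep : ∀ t, ∫ ω, v (X t ω) ∂P
      = ∫ ω, cost C lam (X t ω) (ν t ω) ∂P + α * ∫ ω, v (X (t + 1) ω) ∂P := by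
    intro t
    have i1 := (h.integral_eq_sum t fun z => cost C lam z.1 z.2).1
    have i2 := (h.integral_eq_sum t fun z => α * stepMean q ((z.2 : ℝ) * p) z.1 v).1
    rw [h.integral_queue_succ t v, ← integral_const_mul, ← integral_add i1 i2]
    exact integral_congr_ae (Eventually.of_forall (heq t))
  have hJ := h.hasSum_discountedCost (lam := lam) hC hα0 hα1
  have he := h.tendsto_pow_mul_integral hq0 hq1 hp0 hpq hα0 hα1 hM hv
  have h1 := le_of_hasSum_of_step (e := fun t => ∫ ω, v (X t ω) ∂P) hα0 (fun t => (hstep t).le)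
    hJ he
  have h2 := le_of_hasSum_of_step (e := fun t => -∫ ω, v (X t ω) ∂P)
    (c := fun t => -∫ ω, cost C lam (X t ω) (ν t ω) ∂P) hα0 (fun t => by linarith [hstep t])
    (by simpa only [mul_neg] using hJ.neg) (by simpa only [mul_neg, neg_zero] using he.neg)
  linarith

end Verification

/-! ### The queue under a feedback control -/

/-- The innovation of one time step: for every queue length `k` a number of departures, and a number
of arrivals. -/
abbrev Innovation : Type := (ℕ → ℕ) × ℕ

/-- Number of departures from a queue of length `k` in a given innovation. The minimum matters only
on a null set; it makes the queue dynamics hold surely. -/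
def departures (k : ℕ) (i : Innovation) : ℕ := min (i.1 k) k

/-- Number of arrivals in a given innovation, at most one. -/
def arrivals (i : Innovation) : ℕ := min i.2 1

/-- The queue driven by a sequence of innovations under the feedback control `f`. -/
def feedbackQueue (f : ℕ → ℕ) (x : ℕ) (ω : ℕ → Innovation) : ℕ → ℕ
  | 0 => x
  | t + 1 => feedbackQueue f x ω t - departures (feedbackQueue f x ω t) (ω t)
      + f (feedbackQueue f x ω t) * arrivals (ω t)

/-- Departures of the queue `feedbackQueue`; nothing happens at time `0`. -/
def feedbackDepartures (f : ℕ → ℕ) (x : ℕ) : ℕ → (ℕ → Innovation) → ℕ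
  | 0, _ => 0
  | t + 1, ω => departures (feedbackQueue f x ω t) (ω t)

/-- Arrivals of the queue `feedbackQueue`; nothing happens at time `0`. -/
def feedbackArrivals : ℕ → (ℕ → Innovation) → ℕ
  | 0, _ => 0
  | t + 1, ω => arrivals (ω t)

lemma measurable_departures (k : ℕ) : Measurable (departures k) := by
  unfold departures; fun_prop

lemma measurable_arrivals : Measurable arrivals := by
  unfold arrivals; fun_prop

lemma measurable_departures_comp {Ω : Type*} [MeasurableSpace Ω] {g : Ω → ℕ} (hg : Measurable g)
    (t : ℕ) {e : Ω → ℕ → Innovation} (he : Measurable e) :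
    Measurable fun ω => departures (g ω) (e ω t) := by
  have h : Measurable fun z : ℕ × Innovation => departures z.1 z.2 :=
    measurable_from_prod_countable_right fun k => measurable_departures k
  exact h.comp (hg.prodMk ((measurable_pi_apply t).comp he))

lemma measurable_feedbackQueue (f : ℕ → ℕ) (x t : ℕ) :
    Measurable fun ω => feedbackQueue f x ω t := by
  induction t with
  | zero => exact measurable_const
  | succ t ih =>
    have h1 := measurable_departures_comp ih t measurable_id
    have h2 : Measurable fun ω : ℕ → Innovation => arrivals (ω t) :=
      measurable_arrivals.comp (measurable_pi_apply t)
    have h3 : Measurable fun ω => f (feedbackQueue f x ω t) := Measurable.of_discrete.comp ih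
    exact (ih.sub h1).add (h3.mul h2)

lemma measurable_feedbackDepartures (f : ℕ → ℕ) (x t : ℕ) :
    Measurable (feedbackDepartures f x t) := by
  cases t with
  | zero => exact measurable_const
  | succ t =>
    exact measurable_departures_comp (measurable_feedbackQueue f x t) t measurable_id

lemma measurable_feedbackArrivals (t : ℕ) : Measurable (feedbackArrivals t) := by
  cases t with
  | zero => exact measurable_const
  | succ t => exact measurable_arrivals.comp (measurable_pi_apply t)

lemma feedbackQueue_congr (f : ℕ → ℕ) (x t : ℕ) {ω ω' : ℕ → Innovation}
    (h : ∀ s < t, ω s = ω' s) : feedbackQueue f x ω t = feedbackQueue f x ω' t := by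
  induction t with
  | zero => rfl
  | succ t ih =>
    simp only [feedbackQueue, ih fun s hs => h s (by omega), h t (by omega)]

/-- The law of one innovation: independent departures, binomial with parameters `k` and `q / k` from
a queue of length `k`, and one Bernoulli arrival. -/
def innovationLaw (p : unitInterval) (r : ℕ → unitInterval) : Measure Innovation :=
  (Measure.infinitePi fun k => ProbabilityTheory.binomial k (r k)).prod
    (ProbabilityTheory.binomial 1 p)

instance (p : unitInterval) (r : ℕ → unitInterval) : IsProbabilityMeasure (innovationLaw p r) := by
  unfold innovationLaw; infer_instance

lemma binomial_real_min_eq (n d : ℕ) (r : unitInterval) :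
    (ProbabilityTheory.binomial n r).real {m | min m n = d}
      = n.choose d * (r : ℝ) ^ d * (1 - r) ^ (n - d) := by
  rw [← ProbabilityTheory.binomial_real_singleton]
  refine measureReal_congr ?_
  have h := ProbabilityTheory.ae_le_of_hasLaw_binomial (n := n) (p := r)
    (ProbabilityTheory.HasLaw.id (μ := ProbabilityTheory.binomial n r))
  filter_upwards [h] with m hm
  simp only [id] at hm
  exact propext (show min m n = d ↔ m = d by rw [min_eq_left hm])

lemma innovationLaw_real (p : unitInterval) (r : ℕ → unitInterval) (hr : ∀ k, (r k : ℝ) = q / k)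
    (k d e : ℕ) :
    (innovationLaw p r).real {i | departures k i = d ∧ arrivals i = e}
      = depProb q k d * arrProb p e := by
  have h : {i : Innovation | departures k i = d ∧ arrivals i = e}
      = {g : ℕ → ℕ | min (g k) k = d} ×ˢ {m : ℕ | min m 1 = e} := by
    ext i; rfl
  have h1 : (Measure.infinitePi fun k => ProbabilityTheory.binomial k (r k)).real
      {g : ℕ → ℕ | min (g k) k = d} = depProb q k d := by
    have := (measurePreserving_eval_infinitePi
      (fun k => ProbabilityTheory.binomial k (r k)) k).measureReal_preimage
      (MeasurableSet.of_discrete (s := {m : ℕ | min m k = d})).nullMeasurableSet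
    rw [binomial_real_min_eq, hr] at this
    exact this
  rw [h, innovationLaw, measureReal_prod_prod, h1, binomial_real_min_eq]
  congr 1
  unfold arrProb
  rcases e with _ | _ | e
  · simp
  · simp
  · simp [Nat.choose_eq_zero_of_lt]

/-- Every feedback control is admissible: it is realized on a sequence of independent
innovations. -/
theorem exists_isAdmissible_feedback (hp0 : 0 ≤ p) (hp1 : p ≤ 1) (hq0 : 0 ≤ q) (hq1 : q ≤ 1)
    (f : ℕ → ℕ) (hf : ∀ k, f k = 0 ∨ f k = 1) (x : ℕ) :
    ∃ (Ω : Type) (_ : MeasurableSpace Ω) (P : Measure Ω) (X D ξ ν : ℕ → Ω → ℕ),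
      IsAdmissible p q x P X D ξ ν ∧ ∀ t ω, ν t ω = f (X t ω) := by
  let r : ℕ → unitInterval := fun k => ⟨q / k, div_natCast_mem_Icc hq0 hq1 k⟩
  let μ := innovationLaw ⟨p, hp0, hp1⟩ r
  let X : ℕ → (ℕ → Innovation) → ℕ := fun t ω => feedbackQueue f x ω t
  let ν : ℕ → (ℕ → Innovation) → ℕ := fun t ω => f (X t ω)
  have hν : ∀ t, Measurable (ν t) := fun t =>
    Measurable.of_discrete.comp (measurable_feedbackQueue f x t)
  refine ⟨ℕ → Innovation, inferInstance, Measure.infinitePi fun _ => μ, X, feedbackDepartures f x,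
    feedbackArrivals, ν, ?_, fun t ω => rfl⟩
  refine
    { isProbabilityMeasure := inferInstance
      measurable_queue := measurable_feedbackQueue f x
      measurable_departure := measurable_feedbackDepartures f x
      measurable_arrival := measurable_feedbackArrivals
      measurable_control := hν
      arrival_mem := fun t ω => ?_
      control_mem := fun t ω => hf _
      initial := fun ω => rfl
      dynamics := fun t ω => ?_
      conditional_law := fun t S k d e => ?_ }
  · cases t with
    | zero => exact Or.inl rfl
    | succ t => simp only [feedbackArrivals, arrivals]; omega
  · have : departures (feedbackQueue f x ω t) (ω t) ≤ feedbackQueue f x ω t := min_le_right _ _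
    simp only [X, ν, feedbackQueue, feedbackDepartures, feedbackArrivals]
    omega
  · -- The history up to time `t` is a function of the innovations before `t`, hence independent of
    -- the innovation `ω t` that determines the next departures and arrivals.
    let ext : ((i : Finset.range t) → Innovation) → ℕ → Innovation := fun g s =>
      if h : s ∈ Finset.range t then g ⟨s, h⟩ else (fun _ => 0, 0)
    have hext : Measurable ext := by
      refine measurable_pi_lambda _ fun s => ?_
      by_cases h : s ∈ Finset.range t
      · simp only [ext, h, dite_true]; exact measurable_pi_apply _
      · simp only [ext, h, dite_false]; exact measurable_const
    let B : Set (ℕ → Innovation) :=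
      {ω | history X (feedbackDepartures f x) feedbackArrivals ν t ω ∈ S ∧ X t ω = k}
    have hB : MeasurableSet B := by
      have h1 : Measurable (history X (feedbackDepartures f x) feedbackArrivals ν t) := by
        refine (measurable_feedbackQueue f x 0).prodMk ((measurable_pi_lambda _ fun s =>
          (measurable_feedbackDepartures f x _).prodMk (measurable_feedbackArrivals _)).prodMk
          (measurable_pi_lambda _ fun s => hν _))
      exact (h1 (Set.to_countable S).measurableSet).inter
        (measurable_feedbackQueue f x t (measurableSet_singleton k))
    let A : Set ((i : Finset.range t) → Innovation) := ext ⁻¹' B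
    have hA : MeasurableSet A := hext hB
    have hAB : B = (fun (ω : ℕ → Innovation) (i : Finset.range t) => ω i) ⁻¹' A := by
      ext ω
      have hagree : ∀ s < t, ω s = ext (fun i : Finset.range t => ω i) s := fun s hs => by
        simp [ext, hs]
      have hq : ∀ s ≤ t, X s ω = X s (ext fun i : Finset.range t => ω i) := fun s hs =>
        feedbackQueue_congr f x s fun s' hs' => hagree s' (by omega)
      have hh : history X (feedbackDepartures f x) feedbackArrivals ν t ω
          = history X (feedbackDepartures f x) feedbackArrivals ν t
              (ext fun i : Finset.range t => ω i) := by
        unfold history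
        refine Prod.ext (hq 0 (Nat.zero_le t)) (Prod.ext (funext fun s => ?_) (funext fun s => ?_))
        · have h1 : feedbackQueue f x ω s = _ := hq s s.2.le
          simp only [feedbackDepartures, feedbackArrivals]
          rw [h1, hagree s s.2]
        · exact congrArg f (hq s (by omega))
      simp only [A, B, Set.mem_preimage, Set.mem_ofPred_eq]
      rw [hh, hq t le_rfl]
    let E : Set Innovation := {i | departures k i = d ∧ arrivals i = e}
    have hE : MeasurableSet E :=
      (measurable_departures k (measurableSet_singleton d)).inter
        (measurable_arrivals (measurableSet_singleton e))
    have hiindep : ProbabilityTheory.iIndepFun (fun (s : ℕ) (ω : ℕ → Innovation) => ω s)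
        (Measure.infinitePi fun _ : ℕ => μ) :=
      ProbabilityTheory.iIndepFun_infinitePi (P := fun _ : ℕ => μ) (X := fun _ i => i)
        fun _ => measurable_id
    have hindep : ProbabilityTheory.IndepFun
        (fun (ω : ℕ → Innovation) (i : Finset.range t) => ω i)
        (fun (ω : ℕ → Innovation) (i : ({t} : Finset ℕ)) => ω i)
        (Measure.infinitePi fun _ : ℕ => μ) :=
      hiindep.indepFun_finset (Finset.range t) {t} (by simp) fun s => measurable_pi_apply s
    have heval : Measurable fun g : (i : ({t} : Finset ℕ)) → Innovation => g ⟨t, by simp⟩ := by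
      fun_prop
    have hprod := hindep.measure_inter_preimage_eq_mul A _ hA (heval hE)
    have hset : {ω | history X (feedbackDepartures f x) feedbackArrivals ν t ω ∈ S ∧ X t ω = k ∧
        feedbackDepartures f x (t + 1) ω = d ∧ feedbackArrivals (t + 1) ω = e}
        = B ∩ (fun ω : ℕ → Innovation => ω t) ⁻¹' E := by
      ext ω
      simp only [B, E, Set.mem_inter_iff, Set.mem_ofPred_eq, Set.mem_preimage, feedbackDepartures,
        feedbackArrivals]
      constructor
      · rintro ⟨h1, h2, h3, h4⟩
        refine ⟨⟨h1, h2⟩, ?_, h4⟩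
        rw [← h2]; exact h3
      · rintro ⟨⟨h1, h2⟩, h3, h4⟩
        refine ⟨h1, h2, ?_, h4⟩
        rw [← h2] at h3; exact h3
    have hlaw : (Measure.infinitePi fun _ : ℕ => μ).real ((fun ω : ℕ → Innovation => ω t) ⁻¹' E)
        = depProb q k d * arrProb p e := by
      have := (measurePreserving_eval_infinitePi (fun _ : ℕ => μ) t).measureReal_preimage
        hE.nullMeasurableSet
      exact this.trans (innovationLaw_real _ r (fun _ => rfl) k d e)
    have hreal : (Measure.infinitePi fun _ : ℕ => μ).real
        (B ∩ (fun ω : ℕ → Innovation => ω t) ⁻¹' E)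
        = (Measure.infinitePi fun _ : ℕ => μ).real B
          * (Measure.infinitePi fun _ : ℕ => μ).real
              ((fun ω : ℕ → Innovation => ω t) ⁻¹' E) := by
      rw [hAB]
      simp only [measureReal_def, ← ENNReal.toReal_mul]
      exact congrArg ENNReal.toReal hprod
    rw [hset, hreal, hlaw, mul_comm]

/-! ### The discounted value function -/

/-- A solution of the discounted dynamic programming equation that grows at most like `2 ^ x` is the
discounted value function; the infimum is attained by a feedback control. -/
theorem discountedValue_eq (hC : 0 < C) (hq0 : 0 ≤ q) (hq1 : q ≤ 1) (hp0 : 0 ≤ p)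
    (hpq : 2 * p < q) (hα0 : 0 ≤ α) (hα1 : α < 1) {v : ℕ → ℝ} {M : ℝ} (hM : 0 ≤ M)
    (hvM : ∀ k, |v k| ≤ M * 2 ^ k) (hv : ∀ k, v k = bellman p q C lam α 0 v k) (x : ℕ) :
    discountedValue p q C lam α x = v x := by
  have hact : ∀ k, cost C lam k 1 + α * stepMean q (((1 : ℕ) : ℝ) * p) k v
      = C * k + α * stepMean q p k v := fun k => by simp [cost]
  have hpas : ∀ k, cost C lam k 0 + α * stepMean q (((0 : ℕ) : ℝ) * p) k v
      = C * k + (lam + α * stepMean q 0 k v) := fun k => by simp [cost]; ring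
  have hv' : ∀ k, v k = C * k + min (α * stepMean q p k v) (lam + α * stepMean q 0 k v) :=
    fun k => by rw [← sub_zero (C * (k : ℝ))]; exact hv k
  let f : ℕ → ℕ := fun k => if α * stepMean q p k v ≤ lam + α * stepMean q 0 k v then 1 else 0
  have hf : ∀ k, v k = cost C lam k (f k) + α * stepMean q ((f k : ℝ) * p) k v := by
    intro k
    simp only [f]
    split_ifs with h
    · rw [hact, hv' k, min_eq_left h]
    · rw [hpas, hv' k, min_eq_right (le_of_not_ge h)]
  refine IsLeast.csInf_eq ⟨?_, ?_⟩
  · obtain ⟨Ω, mΩ, P, X, D, ξ, ν, h, hν⟩ := exists_isAdmissible_feedback hp0 (by linarith : p ≤ 1)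
      hq0 hq1 f (fun k => by simp only [f]; split_ifs <;> simp) x
    refine ⟨Ω, mΩ, P, X, D, ξ, ν, h, ?_⟩
    exact h.eq_discountedCost hC hq0 hq1 hp0 hpq hα0 hα1 hM hvM
      fun t ω => by rw [hν]; exact hf _
  · rintro J ⟨Ω, mΩ, P, X, D, ξ, ν, h, rfl⟩
    refine h.le_discountedCost hC hq0 hq1 hp0 hpq hα0 hα1 hM hvM ?_
    rintro k a (rfl | rfl)
    · rw [hpas, hv' k]; gcongr; exact min_le_right _ _
    · rw [hact, hv' k]; gcongr; exact min_le_left _ _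

/-- Value iteration from the zero function preserves monotonicity and converges to the solution of
the discounted equation. -/
lemma monotone_of_eq_bellman (hC : 0 < C) (hq0 : 0 ≤ q) (hq1 : q ≤ 1) (hp0 : 0 ≤ p)
    (hpq : 2 * p < q) (hα0 : 0 ≤ α) (hα1 : α < 1) {v : ℕ → ℝ} {M : ℝ} (hM : 0 ≤ M)
    (hvM : ∀ k, |v k| ≤ M * 2 ^ k) (hv : ∀ k, v k = bellman p q C lam α 0 v k) : Monotone v := by
  have hp1 : p ≤ 1 := by linarith
  let g : ℕ → ℕ → ℝ := fun n => (bellman p q C lam α 0)^[n] fun _ => 0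
  have hg : ∀ n, g (n + 1) = bellman p q C lam α 0 (g n) := fun n =>
    Function.iterate_succ_apply' _ _ _
  have hmono : ∀ n, Monotone (g n) := by
    intro n
    induction n with
    | zero => exact monotone_const
    | succ n ih => rw [hg]; exact (strictMono_bellman hC hq0 hq1 hp0 hp1 hα0 ih).monotone
  have hstep : ∀ (n x : ℕ) (θ : ℝ), 0 ≤ θ → θ ≤ p →
      α * stepMean q θ x (fun k => α ^ n * M * (2 ^ k + n))
        ≤ α ^ (n + 1) * M * (2 ^ x + (n + 1)) := by
    intro n x θ _ h1
    rw [stepMean_const_mul, stepMean_add q θ x (fun k => 2 ^ k) fun _ => (n : ℝ), stepMean_const]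
    have h2 := stepMean_two_pow_le_add_one hq0 hq1 hpq h1 x
    have h3 : 0 ≤ α ^ (n + 1) * M := by positivity
    have := mul_le_mul_of_nonneg_left h2 h3
    rw [pow_succ] at this ⊢
    linarith
  have hdist : ∀ n x, |g n x - v x| ≤ α ^ n * M * (2 ^ x + n) := by
    intro n
    induction n with
    | zero => intro x; simpa [g] using hvM x
    | succ n ih =>
      intro x
      have h1 := bellman_le_add (C := C) (lam := lam) (β := 0) (β' := 0) hq0 hq1 hp0 hp1 hα0
        (f := g n) (g := v) (w := fun k => α ^ n * M * (2 ^ k + n))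
        (fun k => by linarith [(abs_le.1 (ih k)).2]) (hstep n x)
      have h2 := bellman_le_add (C := C) (lam := lam) (β := 0) (β' := 0) hq0 hq1 hp0 hp1 hα0
        (f := v) (g := g n) (w := fun k => α ^ n * M * (2 ^ k + n))
        (fun k => by linarith [(abs_le.1 (ih k)).1]) (hstep n x)
      rw [hg, hv x, abs_le]
      push_cast
      constructor <;> linarith
  have hlim : ∀ x, Tendsto (fun n => g n x) atTop (𝓝 (v x)) := by
    intro x
    rw [tendsto_iff_norm_sub_tendsto_zero]
    refine squeeze_zero (fun n => norm_nonneg _) (fun n => hdist n x) ?_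
    have h1 := tendsto_pow_atTop_nhds_zero_of_lt_one hα0 hα1
    have h2 := tendsto_self_mul_const_pow_of_lt_one hα0 hα1
    have h3 := ((h1.const_mul (2 ^ x)).add h2).const_mul M
    simp only [mul_zero, add_zero] at h3
    exact h3.congr fun n => by ring
  intro x y hxy
  exact le_of_tendsto_of_tendsto' (hlim x) (hlim y) fun n => hmono n hxy

/-- A relative value, shifted by `β / (1 - α)`, solves the discounted dynamic programming
equation. -/
lemma IsRelativeValue.eq_bellman_add (hα1 : α < 1) {u : ℕ → ℝ}
    (h : IsRelativeValue p q C lam α β u) (x : ℕ) :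
    β / (1 - α) + u x = bellman p q C lam α 0 (fun k => β / (1 - α) + u k) x := by
  have hα : 1 - α ≠ 0 := by linarith
  have e : β / (1 - α) = β + α * (β / (1 - α)) := by field_simp; ring
  set c := β / (1 - α)
  have h1 := h.eq_bellman x
  have h2 : ∀ θ, stepMean q θ x (fun k => c + u k) = c + stepMean q θ x u := fun θ => by
    rw [stepMean_add q θ x (fun _ => c) u, stepMean_const]
  unfold bellman at h1 ⊢
  rw [h2, h2, mul_add, mul_add, add_left_comm lam, min_add_add_left]
  linarith

lemma IsRelativeValue.exists_bound_add {u : ℕ → ℝ} (h : IsRelativeValue p q C lam α β u) (c : ℝ) :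
    ∃ M, 0 ≤ M ∧ ∀ x, |c + u x| ≤ M * 2 ^ x := by
  obtain ⟨M, hM, huM⟩ := h.bounded
  refine ⟨|c| + M, by positivity, fun x => (abs_add_le _ _).trans ?_⟩
  have h1 : |c| ≤ |c| * 2 ^ x := le_mul_of_one_le_right (abs_nonneg _) (one_le_pow₀ (by norm_num))
  linarith [huM x]

lemma IsRelativeValue.discountedValue_eq (hC : 0 < C) (hq0 : 0 ≤ q) (hq1 : q ≤ 1) (hp0 : 0 ≤ p)
    (hpq : 2 * p < q) (hα0 : 0 ≤ α) (hα1 : α < 1) {u : ℕ → ℝ}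
    (h : IsRelativeValue p q C lam α β u) (x : ℕ) :
    discountedValue p q C lam α x = β / (1 - α) + u x := by
  obtain ⟨M, hM, huM⟩ := h.exists_bound_add (β / (1 - α))
  exact ProcessorSharing.discountedValue_eq hC hq0 hq1 hp0 hpq hα0 hα1 hM huM
    (h.eq_bellman_add hα1) x

lemma IsRelativeValue.monotone (hC : 0 < C) (hq0 : 0 ≤ q) (hq1 : q ≤ 1) (hp0 : 0 ≤ p)
    (hpq : 2 * p < q) (hα0 : 0 ≤ α) (hα1 : α < 1) {u : ℕ → ℝ}
    (h : IsRelativeValue p q C lam α β u) : Monotone u := by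
  obtain ⟨M, hM, huM⟩ := h.exists_bound_add (β / (1 - α))
  have := monotone_of_eq_bellman hC hq0 hq1 hp0 hpq hα0 hα1 hM huM (h.eq_bellman_add hα1)
  intro x y hxy
  linarith [this hxy]

/-! ### The vanishing discount limit -/

lemma eventually_mem_Ioo_nhdsLT_one : ∀ᶠ α : ℝ in 𝓝[<] 1, α ∈ Set.Ioo (0 : ℝ) 1 :=
  Ioo_mem_nhdsLT zero_lt_one

lemma tendsto_of_abs_sub_le {f : ℝ → ℝ} {a K : ℝ}
    (h : ∀ᶠ α in 𝓝[<] (1 : ℝ), |f α - a| ≤ K * (1 - α)) : Tendsto f (𝓝[<] 1) (𝓝 a) := by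
  rw [tendsto_iff_norm_sub_tendsto_zero]
  refine squeeze_zero' (Eventually.of_forall fun α => norm_nonneg _) h ?_
  have : Tendsto (fun α : ℝ => K * (1 - α)) (𝓝 1) (𝓝 (K * (1 - 1))) :=
    (Continuous.tendsto (by fun_prop) 1)
  rw [sub_self, mul_zero] at this
  exact this.mono_left nhdsWithin_le_nhds

theorem exists_isAverageCostValue (hC : 0 < C) (hq0 : 0 ≤ q) (hq1 : q ≤ 1) (hp0 : 0 ≤ p)
    (hpq : 2 * p < q) (lam : ℝ) : ∃ V β, IsAverageCostValue p q C lam V β := by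
  obtain ⟨β, u, hu⟩ := exists_isRelativeValue hC hq0 hq1 hpq hp0 lam zero_le_one le_rfl
  obtain ⟨K, hK⟩ := hu.abs_sub_le hq0 hq1 hpq hp0
  refine ⟨u, β, fun x => ?_, ?_, solvesDPE_iff.2 hu.eq_bellman⟩
  · refine tendsto_of_abs_sub_le (K := K * 2 ^ x) ?_
    filter_upwards [eventually_mem_Ioo_nhdsLT_one] with α hα
    obtain ⟨β', u', hu'⟩ := exists_isRelativeValue hC hq0 hq1 hpq hp0 lam hα.1.le hα.2.le
    have h := (hK α β' u' hα.1.le hα.2.le hu').2 x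
    rw [hu'.discountedValue_eq hC hq0 hq1 hp0 hpq hα.1.le hα.2,
      hu'.discountedValue_eq hC hq0 hq1 hp0 hpq hα.1.le hα.2, hu'.zero, add_zero,
      add_sub_cancel_left]
    linarith
  · refine tendsto_of_abs_sub_le (K := K) ?_
    filter_upwards [eventually_mem_Ioo_nhdsLT_one] with α hα
    obtain ⟨β', u', hu'⟩ := exists_isRelativeValue hC hq0 hq1 hpq hp0 lam hα.1.le hα.2.le
    have h := (hK α β' u' hα.1.le hα.2.le hu').1
    have h1 : 1 - α ≠ 0 := by linarith [hα.2]
    rw [hu'.discountedValue_eq hC hq0 hq1 hp0 hpq hα.1.le hα.2, hu'.zero, add_zero,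
      mul_div_cancel₀ _ h1]
    exact h

/-- The vanishing discount limit inherits monotonicity from the discounted value functions, and the
average cost equation makes it strict through the term `C x`. -/
theorem IsAverageCostValue.strictMono (hC : 0 < C) (hq0 : 0 ≤ q) (hq1 : q ≤ 1) (hp0 : 0 ≤ p)
    (hpq : 2 * p < q) {V : ℕ → ℝ} (h : IsAverageCostValue p q C lam V β) : StrictMono V := by
  have hV : Monotone V := by
    intro x y hxy
    refine le_of_tendsto_of_tendsto (h.tendsto_value x) (h.tendsto_value y) ?_
    filter_upwards [eventually_mem_Ioo_nhdsLT_one] with α hα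
    obtain ⟨β', u', hu'⟩ := exists_isRelativeValue hC hq0 hq1 hpq hp0 lam hα.1.le hα.2.le
    simp only [hu'.discountedValue_eq hC hq0 hq1 hp0 hpq hα.1.le hα.2]
    linarith [hu'.monotone hC hq0 hq1 hp0 hpq hα.1.le hα.2 hxy]
  have h1 : V = bellman p q C lam 1 β V := funext (solvesDPE_iff.1 h.solvesDPE)
  rw [h1]
  exact strictMono_bellman hC hq0 hq1 hp0 (by linarith) zero_le_one hV

end ProcessorSharing

end

theorem mainTheorem8 (p q C lam : ℝ) (hp : 0 < p) (hpq : 2 * p < q) (hq : q < 1) (hC : 0 < C) :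
    (∃ (V : ℕ → ℝ) (β : ℝ), ProcessorSharing.IsAverageCostValue p q C lam V β) ∧
    ∀ (V : ℕ → ℝ) (β : ℝ), ProcessorSharing.IsAverageCostValue p q C lam V β → StrictMono V := by
  have hq0 : 0 ≤ q := by linarith
  exact ⟨ProcessorSharing.exists_isAverageCostValue hC hq0 hq.le hp.le hpq lam,
    fun _ _ h => h.strictMono hC hq0 hq.le hp.le hpq⟩
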